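/- All matrices are complex; $A^*$ is the conjugate transpose, $\mathscr R(A)$ the column space, $A^\dagger$ the Moore–Penrose inverse, $i_+(A)$ and $i_-(A)$ the numbers of positive and negative eigenvalues, counted with multiplicity, of a Hermitian matrix $A$, and $A\succcurlyeq B$ means that $A-B$ is Hermitian positive semidefinite. Let $A_1\in\mathbb C^{m_1\times m_1}$ and $A_2\in\mathbb C^{m_2\times m_2}$ be Hermitian, let $B_1\in\mathbb C^{m_1\times n}$, $B_2\in\mathbb C^{m_2\times n}$, and assume that the set $$\mathcal T=\{X\in\mathbb C^{n\times n} : X=X^*,\ B_2XB_2^*\succcurlyeq A_2\}$$ is non-empty. Put $\phi(X)=A_1-B_1XB_1^*$ and $$J=\begin{bmatrix}-A_2&B_2\\ B_2^*&0\end{bmatrix},\qquad M=\begin{bmatrix}A_1&0&B_1\\ 0&-A_2&B_2\\ B_1^*&B_2^*&0\end{bmatrix}.$$ Then there is an $X_1\in\mathcal T$ with $\phi(X_1)\succcurlyeq\phi(X)$ for all $X\in\mathcal T$ if and only if $$\mathscr R\begin{bmatrix}0\\ B_1^*\end{bmatrix}\subseteq\mathscr R(J).$$ In this case the matrix $$X_0=[\,0,\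 I_n\,]\,J^\dagger\begin{bmatrix}0\\ I_n\end{bmatrix}$$ is such a global maximizer, that is, $X_0\in\mathcal T$ (in particular $X_0$ is Hermitian) and $\phi(X_0)\succcurlyeq\phi(X)$ for all $X\in\mathcal T$; the greatest element, in the order $\succcurlyeq$, of $\{\phi(X):X\in\mathcal T\}$ is $$S=A_1-[\,0,\ B_1\,]\,J^\dagger\begin{bmatrix}0\\ B_1^*\end{bmatrix};$$ and $$i_+(S)=i_+(M)-i_+(J),\qquad i_-(S)=i_-(M)-i_-(J).$$ -/

import Mathlib

open Matrix
open scoped ComplexOrder MatrixOrder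

section MoorePenrose

/-- The four Penrose equations: `X` is a Moore-Penrose inverse of `A`. -/
structure IsMoorePenrose {m n : Type*} [Fintype m] [Fintype n]
    (A : Matrix m n ℂ) (X : Matrix n m ℂ) : Prop where
  mul_mul_self : A * X * A = A
  self_mul_mul : X * A * X = X
  isHermitian_left : (A * X).IsHermitian
  isHermitian_right : (X * A).IsHermitian

theorem IsMoorePenrose.unique {m n : Type*} [Fintype m] [Fintype n]
    {A : Matrix m n ℂ} {X Y : Matrix n m ℂ}
    (hX : IsMoorePenrose A X) (hY : IsMoorePenrose A Y) : X = Y := by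
  have h1 : A * X = A * Y := by
    have e : (A * X) * (A * Y) = A * Y := by
      rw [← Matrix.mul_assoc, hX.mul_mul_self]
    have e' : (A * Y) * (A * X) = A * X := by
      rw [← Matrix.mul_assoc, hY.mul_mul_self]
    have := congrArg conjTranspose e
    rw [conjTranspose_mul, hX.isHermitian_left.eq, hY.isHermitian_left.eq, e'] at this
    exact this
  have h2 : X * A = Y * A := by
    have e : (Y * A) * (X * A) = Y * A := by
      rw [Matrix.mul_assoc, ← Matrix.mul_assoc A, hX.mul_mul_self]
    have e' : (X * A) * (Y * A) = X * A := by
      rw [Matrix.mul_assoc, ← Matrix.mul_assoc A, hY.mul_mul_self]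
    have := congrArg conjTranspose e
    rw [conjTranspose_mul, hX.isHermitian_right.eq, hY.isHermitian_right.eq, e'] at this
    exact this
  calc X = X * A * X := hX.self_mul_mul.symm
    _ = Y * A * X := by rw [h2]
    _ = Y * A * Y := by rw [Matrix.mul_assoc, h1, Matrix.mul_assoc]
    _ = Y := hY.self_mul_mul

theorem exists_isMoorePenrose {m n : Type*} [Fintype m] [Fintype n]
    (A : Matrix m n ℂ) : ∃ X : Matrix n m ℂ, IsMoorePenrose A X := by
  classical
  have hH : (Aᴴ * A).IsHermitian := isHermitian_conjTranspose_mul_self A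
  obtain ⟨U, d, hU, hd⟩ : ∃ (U : Matrix n n ℂ) (d : n → ℝ), Uᴴ * U = 1 ∧
      Aᴴ * A = U * diagonal (fun i => (d i : ℂ)) * Uᴴ := by
    refine ⟨hH.eigenvectorUnitary, hH.eigenvalues, ?_, ?_⟩
    · exact Unitary.coe_star_mul_self hH.eigenvectorUnitary
    · exact hH.spectral_theorem
  set D : Matrix n n ℂ := diagonal (fun i => (d i : ℂ)) with hD
  set E : Matrix n n ℂ := diagonal (fun i => ((d i)⁻¹ : ℂ)) with hE
  set P : Matrix n n ℂ := U * E * Uᴴ with hP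
  have mulU : ∀ K L : Matrix n n ℂ, (U * K * Uᴴ) * (U * L * Uᴴ) = U * (K * L) * Uᴴ := by
    intro K L
    calc (U * K * Uᴴ) * (U * L * Uᴴ) = U * K * (Uᴴ * U) * L * Uᴴ := by
          simp only [Matrix.mul_assoc]
      _ = _ := by rw [hU]; simp only [Matrix.mul_assoc, Matrix.one_mul]
  have hermU : ∀ K : Matrix n n ℂ, K.IsHermitian → (U * K * Uᴴ).IsHermitian := fun K hK =>
    isHermitian_mul_mul_conjTranspose U hK
  have hEh : E.IsHermitian := by
    refine isHermitian_diagonal_of_self_adjoint _ ?_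
    ext i; simp
  have hEDh : (E * D).IsHermitian := by
    rw [hE, hD, diagonal_mul_diagonal]
    refine isHermitian_diagonal_of_self_adjoint _ ?_
    ext i; simp
  have hPh : P.IsHermitian := hermU E hEh
  have hPH : P * (Aᴴ * A) = U * (E * D) * Uᴴ := by rw [hd, mulU]
  have hDED : D * (E * D) = D := by
    rw [hE, hD, diagonal_mul_diagonal, diagonal_mul_diagonal]
    congr 1; ext i
    by_cases h : d i = 0 <;> simp [h]
  have hEDE : (E * D) * E = E := by
    rw [hE, hD, diagonal_mul_diagonal, diagonal_mul_diagonal]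
    congr 1; ext i
    by_cases h : d i = 0 <;> simp [h]
  have hHPH : (Aᴴ * A) * (P * (Aᴴ * A)) = Aᴴ * A := by
    rw [hPH]
    conv_lhs => rw [hd]
    rw [mulU, hDED, ← hd]
  have hPHh : (P * (Aᴴ * A)).IsHermitian := by rw [hPH]; exact hermU _ hEDh
  have key : A * (P * (Aᴴ * A)) = A := by
    have hz : (A * (P * (Aᴴ * A)) - A)ᴴ * (A * (P * (Aᴴ * A)) - A) = 0 := by
      have h0 : Aᴴ * (A * (P * (Aᴴ * A)) - A) = 0 := by
        rw [Matrix.mul_sub, ← Matrix.mul_assoc, hHPH, sub_self]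
      rw [conjTranspose_sub, conjTranspose_mul, Matrix.sub_mul, Matrix.mul_assoc, h0]
      simp
    exact sub_eq_zero.mp (conjTranspose_mul_self_eq_zero.mp hz)
  refine ⟨P * Aᴴ, ⟨?_, ?_, ?_, ?_⟩⟩
  · simpa only [Matrix.mul_assoc] using key
  · have : P * (Aᴴ * A) * P = P := by rw [hPH, hP, mulU, hEDE]
    calc P * Aᴴ * A * (P * Aᴴ) = (P * (Aᴴ * A) * P) * Aᴴ := by simp only [Matrix.mul_assoc]
      _ = _ := by rw [this]
  · rw [← Matrix.mul_assoc]
    exact isHermitian_mul_mul_conjTranspose A hPh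
  · rw [Matrix.mul_assoc]; exact hPHh

/-- The Moore-Penrose inverse of a complex matrix: the unique solution of the four
Penrose equations. -/
noncomputable def moorePenrose {m n : Type*} [Fintype m] [Fintype n]
    (A : Matrix m n ℂ) : Matrix n m ℂ :=
  Classical.choose (exists_isMoorePenrose A)

theorem isMoorePenrose_moorePenrose {m n : Type*} [Fintype m] [Fintype n]
    (A : Matrix m n ℂ) : IsMoorePenrose A (moorePenrose A) :=
  Classical.choose_spec (exists_isMoorePenrose A)

end MoorePenrose

open Classical in
/-- Positive partial inertia: the number of positive eigenvalues counted with multiplicity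
(`0 < z` on `ℂ` means that `z` is real and positive). -/
noncomputable def posInertia {m : Type*} [Fintype m] [DecidableEq m] (A : Matrix m m ℂ) : ℕ :=
  A.charpoly.roots.countP (fun z => 0 < z)

open Classical in
/-- Negative partial inertia: the number of negative eigenvalues counted with multiplicity. -/
noncomputable def negInertia {m : Type*} [Fintype m] [DecidableEq m] (A : Matrix m m ℂ) : ℕ :=
  A.charpoly.roots.countP (fun z => z < 0)

/-- The range (column space) of a matrix. -/
def colSpace {m n : Type*} [Fintype n] (A : Matrix m n ℂ) : Submodule ℂ (m → ℂ) :=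
  LinearMap.range A.mulVecLin

/-- The Hermitian solutions `X` of the linear matrix inequality `B X B* ≽ A`
(`≤` is the Löwner order: `A ≤ C` iff `C - A` is positive semidefinite). -/
def lmiSolutions {m n : Type*} [Fintype m] [Fintype n]
    (A : Matrix m m ℂ) (B : Matrix m n ℂ) : Set (Matrix n n ℂ) :=
  {X | X.IsHermitian ∧ A ≤ B * X * Bᴴ}

/-- The matrix-valued function `φ(X) = A - B X B*`. -/
def phi {m n : Type*} [Fintype n]
    (A : Matrix m m ℂ) (B : Matrix m n ℂ) (X : Matrix n n ℂ) : Matrix m m ℂ :=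
  A - B * X * Bᴴ

/-- The block matrix `[-A, B; B*, 0]`. -/
def blockJ {m n : Type*} (A : Matrix m m ℂ) (B : Matrix m n ℂ) : Matrix (m ⊕ n) (m ⊕ n) ℂ :=
  fromBlocks (-A) B Bᴴ 0

/-- The block matrix `[A₁, 0, B₁; 0, -A₂, B₂; B₁*, B₂*, 0]`. -/
def blockM {m₁ m₂ n : Type*} (A₁ : Matrix m₁ m₁ ℂ) (B₁ : Matrix m₁ n ℂ)
    (A₂ : Matrix m₂ m₂ ℂ) (B₂ : Matrix m₂ n ℂ) :
    Matrix (m₁ ⊕ (m₂ ⊕ n)) (m₁ ⊕ (m₂ ⊕ n)) ℂ :=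
  fromBlocks A₁ (fromCols 0 B₁) (fromRows 0 B₁ᴴ) (blockJ A₂ B₂)

/-! ### Blocks of the Moore-Penrose inverse of `blockJ` -/

section BlockInverse

variable {m n : Type*} [Fintype m] [Fintype n]

/-! Write J† = [P, Q; Q*, R]. Solvability of B₂XB₂* ≽ A₂ forces P B₂ = 0, and the Penrose equations
then give P A₂ P = -P and B₂RB₂* - A₂ = A₂PA₂ (`exists_moorePenrose_blockJ_eq`). With C = B₂XB₂* -
A₂ for a feasible X, P = PCP ≽ 0, so R is feasible; and (1 + PA₂)* C (1 + PA₂) = B₂XB₂* - B₂RB₂*, so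
B₂RB₂* is least (`isLeast_of_moorePenrose_blockJ_eq`).

Under solvability, the range condition is equivalent to a factorization B₁ = K B₂. Congruence by K
turns minimality of B₂RB₂* into maximality of φ(R). Conversely, a maximizer can be lowered along ker
B₂ without leaving the feasible set, which forces ker B₂ ⊆ ker B₁ and hence the factorization.

For the inertia, S = φ(R) is the generalized Schur complement of J in M. Block elimination makes M
congruent to diag(S, J), and Sylvester's law applies. -/

theorem Matrix.PosSemidef.mul_eq_zero_of_conjTranspose_mul_mul_eq_zero {k : Type*}
    {C : Matrix m m ℂ} (hC : C.PosSemidef) {U : Matrix m k ℂ} (h : Uᴴ * C * U = 0) : C * U = 0 := by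
  classical
  obtain ⟨G, rfl⟩ := CStarAlgebra.nonneg_iff_eq_star_mul_self.mp hC.nonneg
  rw [star_eq_conjTranspose] at h ⊢
  have h0 : (G * U)ᴴ * (G * U) = 0 := by
    rw [conjTranspose_mul, ← h]; simp only [Matrix.mul_assoc]
  rw [Matrix.mul_assoc, conjTranspose_mul_self_eq_zero.mp h0, Matrix.mul_zero]

theorem IsMoorePenrose.conjTranspose {A : Matrix m n ℂ} {X : Matrix n m ℂ}
    (h : IsMoorePenrose A X) : IsMoorePenrose Aᴴ Xᴴ where
  mul_mul_self := by
    rw [← conjTranspose_mul, ← conjTranspose_mul, ← Matrix.mul_assoc, h.mul_mul_self]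
  self_mul_mul := by
    rw [← conjTranspose_mul, ← conjTranspose_mul, ← Matrix.mul_assoc, h.self_mul_mul]
  isHermitian_left := by
    rw [← conjTranspose_mul]; exact h.isHermitian_right.conjTranspose
  isHermitian_right := by
    rw [← conjTranspose_mul]; exact h.isHermitian_left.conjTranspose

theorem moorePenrose_isHermitian {A : Matrix m m ℂ} (hA : A.IsHermitian) :
    (moorePenrose A).IsHermitian := by
  have h := (isMoorePenrose_moorePenrose A).conjTranspose
  rw [hA.eq] at h
  exact h.unique (isMoorePenrose_moorePenrose A)

theorem blockJ_isHermitian {k l : Type*} {A : Matrix k k ℂ} (hA : A.IsHermitian) (B : Matrix k l ℂ) :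
    (blockJ A B).IsHermitian := by
  rw [blockJ, isHermitian_fromBlocks_iff]
  exact ⟨hA.neg, rfl, conjTranspose_conjTranspose B, isHermitian_zero⟩

/-- When the matrix inequality `B X Bᴴ ≽ A` is solvable, the projection onto the range of
`blockJ A B` is block diagonal, which determines the blocks of the Moore-Penrose inverse. -/
theorem exists_moorePenrose_blockJ_eq {A : Matrix m m ℂ} (hA : A.IsHermitian)
    {B : Matrix m n ℂ} (hT : (lmiSolutions A B).Nonempty) :
    ∃ (P : Matrix m m ℂ) (Q : Matrix m n ℂ) (R : Matrix n n ℂ),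
      moorePenrose (blockJ A B) = fromBlocks P Q Qᴴ R ∧
      P.IsHermitian ∧ R.IsHermitian ∧ P * B = 0 ∧ P * A * P = -P ∧ A * Q = B * R ∧
      B * R * Bᴴ - A = A * P * A ∧ Bᴴ * Q * Bᴴ = Bᴴ := by
  obtain ⟨X, hX, hle⟩ := hT
  have hC : (B * X * Bᴴ - A).PosSemidef := le_iff.mp hle
  have hG := moorePenrose_isHermitian (blockJ_isHermitian hA B)
  have hmp := isMoorePenrose_moorePenrose (blockJ A B)
  obtain ⟨P, Q, Q', R, e⟩ : ∃ P Q Q' R, moorePenrose (blockJ A B) = fromBlocks P Q Q' R :=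
    ⟨_, _, _, _, (fromBlocks_toBlocks _).symm⟩
  rw [e] at hG hmp ⊢
  obtain ⟨hP, rfl, -, hR⟩ := isHermitian_fromBlocks_iff.mp hG
  obtain ⟨h1, h2, h3, h4⟩ := hmp
  simp only [blockJ, fromBlocks_multiply, fromBlocks_inj, isHermitian_fromBlocks_iff] at h1 h2 h3 h4
  simp only [Matrix.zero_mul, Matrix.mul_zero, add_zero, Matrix.mul_neg, Matrix.neg_mul,
    Matrix.add_mul] at h1 h2 h3 h4
  obtain ⟨h11, h12, h13, h14⟩ := h1
  obtain ⟨h21, -⟩ := h2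
  obtain ⟨-, h32, -, -⟩ := h3
  obtain ⟨-, h42, -, -⟩ := h4
  -- Put N = PB. The blocks of JGJ = J give B*N = 0 and AN = B(Q*B - 1), so N*AN = 0 and the
  -- positive semidefinite matrix BXB* - A kills N. Hence AN = 0.
  have hPB : P * B = 0 := by
    have hN : Bᴴ * (P * B) = 0 := by rw [← Matrix.mul_assoc, h14]
    have hN' : (P * B)ᴴ * B = 0 := by
      rw [conjTranspose_mul, hP.eq, h14]
    have hAN : A * (P * B) = B * (Qᴴ * B) - B := by
      rw [← Matrix.mul_assoc, ← Matrix.mul_assoc]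
      linear_combination (norm := (simp only [Matrix.mul_assoc]; abel)) -h12
    have hCN : (B * X * Bᴴ - A) * (P * B) = 0 := by
      apply hC.mul_eq_zero_of_conjTranspose_mul_mul_eq_zero
      rw [Matrix.mul_assoc, Matrix.sub_mul, Matrix.mul_assoc _ Bᴴ, hN, hAN, Matrix.mul_zero,
        zero_sub, Matrix.mul_neg, Matrix.mul_sub, ← Matrix.mul_assoc, hN', Matrix.zero_mul, sub_zero,
        neg_zero]
    have hAN' : A * (P * B) = 0 := by
      rw [Matrix.sub_mul, Matrix.mul_assoc _ Bᴴ, hN, Matrix.mul_zero, zero_sub, neg_eq_zero] at hCN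
      exact hCN
    -- Hermitianness of GJ expresses N* as -Q*A + RB*, and both A and B* annihilate N.
    apply conjTranspose_mul_self_eq_zero.mp
    rw [h42, Matrix.add_mul, Matrix.neg_mul, Matrix.mul_assoc, Matrix.mul_assoc, hAN', hN]
    simp
  have hAQ : A * Q = B * R := by
    have h0 : -(A * Q) + B * R = 0 := by
      rw [← conjTranspose_conjTranspose (-(A * Q) + B * R), h32, conjTranspose_mul,
        conjTranspose_conjTranspose, hP.eq, hPB]
    exact (neg_add_eq_zero.mp h0)
  have hBP : Bᴴ * P = 0 := by
    rw [← hP.eq, ← conjTranspose_mul, hPB, conjTranspose_zero]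
  rw [Matrix.mul_assoc Q, hBP, hPB, Matrix.mul_zero, Matrix.zero_mul, add_zero, add_zero] at h21
  rw [hBP, Matrix.zero_mul, neg_zero, zero_add] at h13
  have hAPA : A * Q * Bᴴ - A = A * P * A := by
    rw [hAQ, neg_add_cancel, add_zero] at h11
    have h0 := congrArg Matrix.conjTranspose h11
    simp only [conjTranspose_neg, conjTranspose_add, conjTranspose_mul, hA.eq, hP.eq,
      conjTranspose_conjTranspose, ← Matrix.mul_assoc] at h0
    linear_combination (norm := abel) -h0
  exact ⟨P, Q, R, rfl, hP, hR, hPB, neg_eq_iff_eq_neg.mp h21, hAQ, hAQ ▸ hAPA, h13⟩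

theorem fromRows_zero_eq_blockJ_mul {k : Type*} [Fintype k] {A : Matrix m m ℂ} {B : Matrix m n ℂ}
    {L : Matrix k n ℂ} (h : colSpace (fromRows (0 : Matrix m k ℂ) Lᴴ) ≤ colSpace (blockJ A B)) :
    ∃ Y : Matrix (m ⊕ n) k ℂ, fromRows 0 Lᴴ = blockJ A B * Y := by
  classical
  have hmem : ∀ j, ∃ y, blockJ A B *ᵥ y = (fromRows (0 : Matrix m k ℂ) Lᴴ).col j := by
    intro j
    apply h
    exact ⟨Pi.single j 1, by simp⟩
  choose y hy using hmem
  refine ⟨(Matrix.of y)ᵀ, ?_⟩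
  ext i j
  exact (congrFun (hy j) i).symm

end BlockInverse

/-! ### Sylvester's law and Schur complements -/

section Inertia

variable {m n : Type*} [Fintype m] [Fintype n] [DecidableEq m] [DecidableEq n]

theorem posInertia_eq_card {A : Matrix m m ℂ} (hA : A.IsHermitian) :
    posInertia A = Fintype.card {i // 0 < hA.eigenvalues i} := by
  classical
  rw [posInertia, hA.roots_charpoly_eq_eigenvalues, Multiset.countP_map, Fintype.card_subtype]
  simp [Finset.card_def]

theorem negInertia_eq_card {A : Matrix m m ℂ} (hA : A.IsHermitian) :
    negInertia A = Fintype.card {i // 0 < -hA.eigenvalues i} := by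
  classical
  rw [negInertia, hA.roots_charpoly_eq_eigenvalues, Multiset.countP_map, Fintype.card_subtype]
  simp only [Function.comp_apply, Finset.card_def, Finset.filter_val, neg_pos]
  congr 2
  ext i
  exact Complex.real_lt_real

theorem posInertia_fromBlocks_zero (A : Matrix m m ℂ) (D : Matrix n n ℂ) :
    posInertia (fromBlocks A 0 0 D) = posInertia A + posInertia D := by
  classical
  rw [posInertia, charpoly_fromBlocks_zero₁₂, Polynomial.roots_mul, Multiset.countP_add]
  · rfl
  · exact mul_ne_zero (charpoly_monic _).ne_zero (charpoly_monic _).ne_zero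

theorem negInertia_fromBlocks_zero (A : Matrix m m ℂ) (D : Matrix n n ℂ) :
    negInertia (fromBlocks A 0 0 D) = negInertia A + negInertia D := by
  classical
  rw [negInertia, charpoly_fromBlocks_zero₁₂, Polynomial.roots_mul, Multiset.countP_add]
  · rfl
  · exact mul_ne_zero (charpoly_monic _).ne_zero (charpoly_monic _).ne_zero

theorem star_dotProduct_diagonal_mulVec (d : m → ℝ) (v : m → ℂ) :
    star v ⬝ᵥ (diagonal (fun i => (d i : ℂ)) *ᵥ v) =
      ((∑ i, d i * Complex.normSq (v i) : ℝ) : ℂ) := by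
  simp only [dotProduct, mulVec_diagonal, Pi.star_apply, Complex.ofReal_sum, Complex.ofReal_mul,
    Complex.normSq_eq_conj_mul_self]
  refine Finset.sum_congr rfl fun i _ => ?_
  rw [← starRingEnd_apply]
  ring

theorem diagonal_neg_ofReal {ι : Type*} [DecidableEq ι] (d : ι → ℝ) :
    diagonal (fun i => ((-d i : ℝ) : ℂ)) = -diagonal (fun i => (d i : ℂ)) := by
  ext i j
  by_cases h : i = j <;> simp [h]

/-- The core of Sylvester's law. Send c to the coordinates of W*c at which d is positive. If these
all vanish, the form of e at c, which is that of d at W*c, is at most 0, so c = 0. The map is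
injective and dimensions compare. -/
theorem card_le_card_pos_of_diagonal_eq {d : m → ℝ} {e : n → ℝ} (he : ∀ i, 0 < e i)
    {W : Matrix n m ℂ}
    (h : diagonal (fun i => (e i : ℂ)) = W * diagonal (fun i => (d i : ℂ)) * Wᴴ) :
    Fintype.card n ≤ Fintype.card {k // 0 < d k} := by
  let f : (n → ℂ) →ₗ[ℂ] ({k // 0 < d k} → ℂ) := (Wᴴ.submatrix Subtype.val id).mulVecLin
  have hf : Function.Injective f := by
    rw [← LinearMap.ker_eq_bot, LinearMap.ker_eq_bot']
    intro c hc
    have hz : ∀ k, 0 < d k → (Wᴴ *ᵥ c) k = 0 := fun k hk => congrFun hc ⟨k, hk⟩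
    have hq : ∑ i, e i * Complex.normSq (c i) = ∑ k, d k * Complex.normSq ((Wᴴ *ᵥ c) k) := by
      have := star_dotProduct_diagonal_mulVec e c
      rw [h, ← mulVec_mulVec, ← mulVec_mulVec, dotProduct_mulVec, ← conjTranspose_conjTranspose W,
        ← star_mulVec, conjTranspose_conjTranspose, star_dotProduct_diagonal_mulVec] at this
      exact_mod_cast this.symm
    have hle : ∑ i, e i * Complex.normSq (c i) ≤ 0 := by
      rw [hq]
      refine Finset.sum_nonpos fun k _ => ?_
      by_cases hk : 0 < d k
      · simp [hz k hk]
      · exact mul_nonpos_of_nonpos_of_nonneg (not_lt.mp hk) (Complex.normSq_nonneg _)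
    have hnn : ∀ i ∈ Finset.univ, 0 ≤ e i * Complex.normSq (c i) := fun i _ =>
      mul_nonneg (he i).le (Complex.normSq_nonneg _)
    have h0 := (Finset.sum_eq_zero_iff_of_nonneg hnn).mp (le_antisymm hle (Finset.sum_nonneg hnn))
    ext i
    simpa [(he i).ne'] using h0 i (Finset.mem_univ i)
  simpa using LinearMap.finrank_le_finrank_of_injective hf

theorem card_pos_le_card_pos_of_diagonal_eq {d : m → ℝ} {e : n → ℝ} {W : Matrix n m ℂ}
    (h : diagonal (fun i => (e i : ℂ)) = W * diagonal (fun i => (d i : ℂ)) * Wᴴ) :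
    Fintype.card {i // 0 < e i} ≤ Fintype.card {k // 0 < d k} := by
  refine card_le_card_pos_of_diagonal_eq (e := fun i : {i // 0 < e i} => e i)
    (W := W.submatrix Subtype.val id) (fun i => i.2) ?_
  ext i j
  have := congrFun (congrFun h i.1) j.1
  simp only [diagonal_apply, Subtype.ext_iff, Matrix.mul_apply, submatrix_apply,
    conjTranspose_apply, id] at this ⊢
  exact this

theorem exists_diagonal_eigenvalues_eq {A : Matrix m m ℂ} (hA : A.IsHermitian) {B : Matrix n n ℂ}
    (hB : B.IsHermitian) {W : Matrix n m ℂ} (h : B = W * A * Wᴴ) :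
    ∃ V : Matrix n m ℂ, diagonal (fun i => (hB.eigenvalues i : ℂ)) =
      V * diagonal (fun i => (hA.eigenvalues i : ℂ)) * Vᴴ := by
  have hsA : A = (hA.eigenvectorUnitary : Matrix m m ℂ) *
      diagonal (fun i => (hA.eigenvalues i : ℂ)) * (hA.eigenvectorUnitary : Matrix m m ℂ)ᴴ :=
    hA.spectral_theorem
  have hsB : B = (hB.eigenvectorUnitary : Matrix n n ℂ) *
      diagonal (fun i => (hB.eigenvalues i : ℂ)) * (hB.eigenvectorUnitary : Matrix n n ℂ)ᴴ :=
    hB.spectral_theorem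
  have hU : (hB.eigenvectorUnitary : Matrix n n ℂ)ᴴ * (hB.eigenvectorUnitary : Matrix n n ℂ) = 1 :=
    Unitary.coe_star_mul_self hB.eigenvectorUnitary
  generalize (hA.eigenvectorUnitary : Matrix m m ℂ) = U at hsA
  generalize (hB.eigenvectorUnitary : Matrix n n ℂ) = V at hsB hU
  generalize diagonal (fun i => (hA.eigenvalues i : ℂ)) = D at hsA ⊢
  generalize diagonal (fun i => (hB.eigenvalues i : ℂ)) = E at hsB ⊢
  have hE : E = Vᴴ * B * V := by
    rw [hsB]
    calc E = (Vᴴ * V) * E * (Vᴴ * V) := by rw [hU, Matrix.one_mul, Matrix.mul_one]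
      _ = _ := by simp only [Matrix.mul_assoc]
  refine ⟨Vᴴ * W * U, ?_⟩
  rw [hE, h, hsA]
  simp only [conjTranspose_mul, conjTranspose_conjTranspose, Matrix.mul_assoc]

/-- W may be any rectangular matrix, so only an inequality holds; a congruence by an invertible
matrix gives equality by applying it in both directions. -/
theorem posInertia_le_of_eq_mul_mul_conjTranspose {A : Matrix m m ℂ} (hA : A.IsHermitian)
    {B : Matrix n n ℂ} {W : Matrix n m ℂ} (h : B = W * A * Wᴴ) :
    posInertia B ≤ posInertia A := by
  have hB : B.IsHermitian := h ▸ isHermitian_mul_mul_conjTranspose W hA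
  obtain ⟨V, hV⟩ := exists_diagonal_eigenvalues_eq hA hB h
  rw [posInertia_eq_card hA, posInertia_eq_card hB]
  exact card_pos_le_card_pos_of_diagonal_eq hV

theorem negInertia_le_of_eq_mul_mul_conjTranspose {A : Matrix m m ℂ} (hA : A.IsHermitian)
    {B : Matrix n n ℂ} {W : Matrix n m ℂ} (h : B = W * A * Wᴴ) :
    negInertia B ≤ negInertia A := by
  have hB : B.IsHermitian := h ▸ isHermitian_mul_mul_conjTranspose W hA
  obtain ⟨V, hV⟩ := exists_diagonal_eigenvalues_eq hA hB h
  rw [negInertia_eq_card hA, negInertia_eq_card hB]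
  refine card_pos_le_card_pos_of_diagonal_eq (d := fun i => -hA.eigenvalues i)
    (e := fun i => -hB.eigenvalues i) (W := V) ?_
  rw [diagonal_neg_ofReal, diagonal_neg_ofReal, hV, Matrix.mul_neg, Matrix.neg_mul]

/-- Inertia is additive along a generalized Schur complement. -/
theorem inertia_fromBlocks_of_mul_eq {A : Matrix m m ℂ} (hA : A.IsHermitian) {J G : Matrix n n ℂ}
    (hJ : J.IsHermitian) (hG : G.IsHermitian) {L : Matrix n m ℂ} (hL : J * G * L = L) :
    posInertia (fromBlocks A Lᴴ L J) = posInertia (A - Lᴴ * G * L) + posInertia J ∧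
      negInertia (fromBlocks A Lᴴ L J) = negInertia (A - Lᴴ * G * L) + negInertia J := by
  have hL' : Lᴴ * G * J = Lᴴ := by
    have := congrArg Matrix.conjTranspose hL
    rwa [conjTranspose_mul, conjTranspose_mul, hJ.eq, hG.eq, ← Matrix.mul_assoc] at this
  have hS : (A - Lᴴ * G * L).IsHermitian :=
    hA.sub (isHermitian_conjTranspose_mul_mul L hG)
  have hM : (fromBlocks A Lᴴ L J).IsHermitian :=
    isHermitian_fromBlocks_iff.mpr ⟨hA, conjTranspose_conjTranspose L, rfl, hJ⟩
  have hD : (fromBlocks (A - Lᴴ * G * L) 0 0 J).IsHermitian :=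
    isHermitian_fromBlocks_iff.mpr ⟨hS, by simp, by simp, hJ⟩
  -- Since JGL = L, the block L*G eliminates the off-diagonal entries just as L*J⁻¹ would for
  -- invertible J.
  have h1 : fromBlocks A Lᴴ L J = fromBlocks 1 (Lᴴ * G) 0 1 *
      fromBlocks (A - Lᴴ * G * L) 0 0 J * (fromBlocks 1 (Lᴴ * G) 0 1)ᴴ := by
    simp only [fromBlocks_conjTranspose, fromBlocks_multiply, conjTranspose_mul, hG.eq,
      conjTranspose_conjTranspose, conjTranspose_one, conjTranspose_zero, Matrix.one_mul,
      Matrix.mul_one, Matrix.zero_mul, Matrix.mul_zero, zero_add, add_zero, hL']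
    rw [← Matrix.mul_assoc, ← Matrix.mul_assoc, hL, sub_add_cancel]
  have h2 : fromBlocks (A - Lᴴ * G * L) 0 0 J = fromBlocks 1 (-(Lᴴ * G)) 0 1 *
      fromBlocks A Lᴴ L J * (fromBlocks 1 (-(Lᴴ * G)) 0 1)ᴴ := by
    simp only [fromBlocks_conjTranspose, fromBlocks_multiply, conjTranspose_mul, hG.eq,
      conjTranspose_conjTranspose, conjTranspose_one, conjTranspose_zero, conjTranspose_neg,
      Matrix.one_mul, Matrix.mul_one, Matrix.zero_mul, Matrix.mul_zero, zero_add, add_zero,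
      Matrix.neg_mul, Matrix.mul_neg, hL', add_neg_cancel, neg_zero]
    rw [← Matrix.mul_assoc J, hL, add_neg_cancel, sub_eq_add_neg]
  rw [← posInertia_fromBlocks_zero, ← negInertia_fromBlocks_zero]
  exact ⟨le_antisymm (posInertia_le_of_eq_mul_mul_conjTranspose hD h1)
      (posInertia_le_of_eq_mul_mul_conjTranspose hM h2),
    le_antisymm (negInertia_le_of_eq_mul_mul_conjTranspose hD h1)
      (negInertia_le_of_eq_mul_mul_conjTranspose hM h2)⟩

end Inertia

/-! ### Feasible perturbations and the extremal solution -/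

section Maximizer

variable {m₁ m₂ n : Type*} [Fintype m₁] [Fintype m₂] [Fintype n]
  {A₁ : Matrix m₁ m₁ ℂ} {A₂ : Matrix m₂ m₂ ℂ} {B₁ : Matrix m₁ n ℂ} {B₂ : Matrix m₂ n ℂ}

/-- Subtracting FF* from X₁ leaves B₂X₁B₂* unchanged but adds (B₁F)(B₁F)* ≽ 0 to φ, so maximality
forces that term to vanish. -/
theorem mul_eq_zero_of_isMaxOn_phi {X₁ F : Matrix n n ℂ} (hX₁ : X₁ ∈ lmiSolutions A₂ B₂)
    (hmax : ∀ X ∈ lmiSolutions A₂ B₂, phi A₁ B₁ X ≤ phi A₁ B₁ X₁) (hF : B₂ * F = 0) :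
    B₁ * F = 0 := by
  have hmem : X₁ - F * Fᴴ ∈ lmiSolutions A₂ B₂ := by
    refine ⟨hX₁.1.sub (isHermitian_mul_conjTranspose_self F), ?_⟩
    rw [Matrix.mul_sub, ← Matrix.mul_assoc, hF, Matrix.zero_mul, sub_zero]
    exact hX₁.2
  have hle : B₁ * F * (B₁ * F)ᴴ ≤ 0 := by
    have h := hmax _ hmem
    have e : phi A₁ B₁ (X₁ - F * Fᴴ) = phi A₁ B₁ X₁ + B₁ * F * (B₁ * F)ᴴ := by
      simp only [phi, conjTranspose_mul, Matrix.mul_sub, Matrix.sub_mul, Matrix.mul_assoc]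
      abel
    rw [e] at h
    exact (add_le_iff_nonpos_right _).mp h
  exact self_mul_conjTranspose_eq_zero.mp
    (le_antisymm hle (posSemidef_self_mul_conjTranspose _).nonneg)

theorem exists_eq_mul_of_isMaxOn_phi {X₁ : Matrix n n ℂ} (hX₁ : X₁ ∈ lmiSolutions A₂ B₂)
    (hmax : ∀ X ∈ lmiSolutions A₂ B₂, phi A₁ B₁ X ≤ phi A₁ B₁ X₁) :
    ∃ K : Matrix m₁ m₂ ℂ, B₁ = K * B₂ := by
  classical
  -- Take F to be the orthogonal projection onto ker B₂; then B₁F = 0 reads B₁ = B₁B₂†B₂.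
  have hF : B₂ * (1 - moorePenrose B₂ * B₂) = 0 := by
    rw [Matrix.mul_sub, Matrix.mul_one, ← Matrix.mul_assoc,
      (isMoorePenrose_moorePenrose B₂).mul_mul_self, sub_self]
  refine ⟨B₁ * moorePenrose B₂, ?_⟩
  have h := mul_eq_zero_of_isMaxOn_phi hX₁ hmax hF
  rw [Matrix.mul_sub, Matrix.mul_one, sub_eq_zero] at h
  rw [Matrix.mul_assoc, ← h]

/-- The projection JJ† has zero upper right block, and its lower right block B₂*Q fixes B₂*. This
gives both the range inclusion and the hypothesis of the Schur complement step. -/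
theorem blockJ_mul_moorePenrose_mul_fromRows_zero {k : Type*} (hA₂ : A₂.IsHermitian)
    (hT : (lmiSolutions A₂ B₂).Nonempty) (K : Matrix k m₂ ℂ) :
    blockJ A₂ B₂ * moorePenrose (blockJ A₂ B₂) * fromRows (0 : Matrix m₂ k ℂ) (K * B₂)ᴴ =
      fromRows 0 (K * B₂)ᴴ := by
  obtain ⟨P, Q, R, e, hP, -, hPB, -, hAQ, -, hQ⟩ := exists_moorePenrose_blockJ_eq hA₂ hT
  rw [e, blockJ, fromBlocks_multiply, fromBlocks_mul_fromRows]
  rw [Matrix.neg_mul _ Q, hAQ, neg_add_cancel, Matrix.zero_mul, Matrix.mul_zero, add_zero,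
    Matrix.mul_zero, zero_add, Matrix.zero_mul, add_zero, conjTranspose_mul, ← Matrix.mul_assoc, hQ]

theorem fromCols_mul_fromBlocks_mul_fromRows {k l : Type*} (P : Matrix m₂ m₂ ℂ)
    (Q : Matrix m₂ n ℂ) (Q' : Matrix n m₂ ℂ) (R : Matrix n n ℂ) (L : Matrix k n ℂ)
    (N : Matrix n l ℂ) :
    fromCols (0 : Matrix k m₂ ℂ) L * fromBlocks P Q Q' R * fromRows (0 : Matrix m₂ l ℂ) N =
      L * R * N := by
  rw [fromCols_mul_fromBlocks, fromCols_mul_fromRows]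
  simp

/-- The lower right block of the Moore-Penrose inverse solves the inequality and is minimal up to
congruence by `B₂`. -/
theorem isLeast_of_moorePenrose_blockJ_eq (hA₂ : A₂.IsHermitian)
    {P : Matrix m₂ m₂ ℂ} {R : Matrix n n ℂ} (hT : (lmiSolutions A₂ B₂).Nonempty)
    (hP : P.IsHermitian) (hR : R.IsHermitian) (hPB : P * B₂ = 0) (hPAP : P * A₂ * P = -P)
    (hAPA : B₂ * R * B₂ᴴ - A₂ = A₂ * P * A₂) :
    R ∈ lmiSolutions A₂ B₂ ∧
      ∀ X ∈ lmiSolutions A₂ B₂, B₂ * R * B₂ᴴ ≤ B₂ * X * B₂ᴴ := by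
  classical
  have hBP : B₂ᴴ * P = 0 := by
    rw [← hP.eq, ← conjTranspose_mul, hPB, conjTranspose_zero]
  have hPC (X : Matrix n n ℂ) : P * (B₂ * X * B₂ᴴ - A₂) = -(P * A₂) := by
    rw [Matrix.mul_sub, ← Matrix.mul_assoc, ← Matrix.mul_assoc, hPB]; simp
  have hCP (X : Matrix n n ℂ) : (B₂ * X * B₂ᴴ - A₂) * P = -(A₂ * P) := by
    rw [Matrix.sub_mul, Matrix.mul_assoc _ B₂ᴴ, hBP]; simp
  have hPpos : P.PosSemidef := by
    -- For any feasible X, P(B₂XB₂* - A₂)P = -PA₂P = P.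
    obtain ⟨X, -, hX⟩ := hT
    have h := (le_iff.mp hX).conjTranspose_mul_mul_same P
    rwa [hP.eq, hPC, Matrix.neg_mul, hPAP, neg_neg] at h
  refine ⟨⟨hR, ?_⟩, fun X hX => ?_⟩
  · rw [le_iff, hAPA]
    have h := hPpos.conjTranspose_mul_mul_same A₂
    rwa [hA₂.eq] at h
  -- Right multiplication by 1 + PA₂ replaces the term A₂ by B₂RB₂*; the adjoint factor on the left
  -- then acts trivially because PB₂ = 0.
  · have h := (le_iff.mp hX.2).conjTranspose_mul_mul_same (1 + P * A₂)
    have e : (1 + P * A₂)ᴴ * (B₂ * X * B₂ᴴ - A₂) * (1 + P * A₂) =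
        B₂ * X * B₂ᴴ - B₂ * R * B₂ᴴ := by
      have h1 : (B₂ * X * B₂ᴴ - A₂) * (1 + P * A₂) = B₂ * X * B₂ᴴ - B₂ * R * B₂ᴴ := by
        rw [Matrix.mul_add, Matrix.mul_one, ← Matrix.mul_assoc, hCP, Matrix.neg_mul, ← hAPA]
        abel
      rw [Matrix.mul_assoc, h1, conjTranspose_add, conjTranspose_one, conjTranspose_mul, hA₂.eq,
        hP.eq, Matrix.add_mul, Matrix.one_mul, Matrix.mul_assoc A₂, Matrix.mul_sub P]
      simp only [← Matrix.mul_assoc, hPB, Matrix.zero_mul, sub_self, Matrix.mul_zero, add_zero]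
    rw [e] at h
    exact h

theorem phi_le_phi_of_eq_mul {K : Matrix m₁ m₂ ℂ} {R X : Matrix n n ℂ}
    (h : B₂ * R * B₂ᴴ ≤ B₂ * X * B₂ᴴ) : phi A₁ (K * B₂) X ≤ phi A₁ (K * B₂) R := by
  rw [le_iff] at h ⊢
  have h' := h.mul_mul_conjTranspose_same K
  convert h' using 1
  simp only [phi, conjTranspose_mul, Matrix.mul_sub, Matrix.sub_mul, Matrix.mul_assoc]
  abel

end Maximizer

/-! ### The main theorem -/

theorem theorem4p1 (m₁ m₂ n : ℕ)
    (A₁ : Matrix (Fin m₁) (Fin m₁) ℂ) (A₂ : Matrix (Fin m₂) (Fin m₂) ℂ)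
    (B₁ : Matrix (Fin m₁) (Fin n) ℂ) (B₂ : Matrix (Fin m₂) (Fin n) ℂ)
    (hA₁ : A₁.IsHermitian) (hA₂ : A₂.IsHermitian)
    (hcons : (lmiSolutions A₂ B₂).Nonempty) :
    -- existence of a global maximizer
    ((∃ X₁ ∈ lmiSolutions A₂ B₂, ∀ X ∈ lmiSolutions A₂ B₂, phi A₁ B₁ X ≤ phi A₁ B₁ X₁) ↔
      colSpace (fromRows (0 : Matrix (Fin m₂) (Fin m₁) ℂ) B₁ᴴ) ≤ colSpace (blockJ A₂ B₂)) ∧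
    (colSpace (fromRows (0 : Matrix (Fin m₂) (Fin m₁) ℂ) B₁ᴴ) ≤ colSpace (blockJ A₂ B₂) →
      -- the explicit global maximizer
      (∃ X₀ : Matrix (Fin n) (Fin n) ℂ,
        X₀ = fromCols (0 : Matrix (Fin n) (Fin m₂) ℂ) (1 : Matrix (Fin n) (Fin n) ℂ) *
            moorePenrose (blockJ A₂ B₂) *
            fromRows (0 : Matrix (Fin m₂) (Fin n) ℂ) (1 : Matrix (Fin n) (Fin n) ℂ) ∧
        X₀ ∈ lmiSolutions A₂ B₂ ∧
        ∀ X ∈ lmiSolutions A₂ B₂, phi A₁ B₁ X ≤ phi A₁ B₁ X₀) ∧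
      -- the global maximal matrix and its inertia
      (∃ S : Matrix (Fin m₁) (Fin m₁) ℂ,
        S = A₁ - fromCols (0 : Matrix (Fin m₁) (Fin m₂) ℂ) B₁ *
            moorePenrose (blockJ A₂ B₂) *
            fromRows (0 : Matrix (Fin m₂) (Fin m₁) ℂ) B₁ᴴ ∧
        IsGreatest (phi A₁ B₁ '' lmiSolutions A₂ B₂) S ∧
        (posInertia S : ℤ) = posInertia (blockM A₁ B₁ A₂ B₂) - posInertia (blockJ A₂ B₂) ∧
        (negInertia S : ℤ) = negInertia (blockM A₁ B₁ A₂ B₂) - negInertia (blockJ A₂ B₂))) := by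
  have hJ := blockJ_isHermitian hA₂ B₂
  obtain ⟨P, Q, R, e, hP, hR, hPB, hPAP, -, hAPA, -⟩ := exists_moorePenrose_blockJ_eq hA₂ hcons
  obtain ⟨hRmem, hRmin⟩ := isLeast_of_moorePenrose_blockJ_eq hA₂ hcons hP hR hPB hPAP hAPA
  have hfactor : colSpace (fromRows (0 : Matrix (Fin m₂) (Fin m₁) ℂ) B₁ᴴ) ≤
      colSpace (blockJ A₂ B₂) → ∃ K : Matrix (Fin m₁) (Fin m₂) ℂ, B₁ = K * B₂ := by
    intro h
    obtain ⟨Y, hY⟩ := fromRows_zero_eq_blockJ_mul h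
    rw [← fromRows_toRows Y, blockJ, fromBlocks_mul_fromRows, fromRows_ext_iff] at hY
    -- The lower block row of JY is B₂*Y₁, so B₁* = B₂*Y₁.
    refine ⟨Y.toRows₁ᴴ, ?_⟩
    rw [← conjTranspose_conjTranspose B₁, hY.2, Matrix.zero_mul, add_zero, conjTranspose_mul,
      conjTranspose_conjTranspose]
  have hmax : colSpace (fromRows (0 : Matrix (Fin m₂) (Fin m₁) ℂ) B₁ᴴ) ≤
      colSpace (blockJ A₂ B₂) → ∀ X ∈ lmiSolutions A₂ B₂, phi A₁ B₁ X ≤ phi A₁ B₁ R := by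
    intro h X hX
    obtain ⟨K, rfl⟩ := hfactor h
    exact phi_le_phi_of_eq_mul (hRmin X hX)
  refine ⟨⟨?_, fun h => ⟨R, hRmem, hmax h⟩⟩, fun h => ⟨⟨_, rfl, ?_⟩, ⟨_, rfl, ?_, ?_⟩⟩⟩
  · rintro ⟨X₁, hX₁, hX₁max⟩
    obtain ⟨K, rfl⟩ := exists_eq_mul_of_isMaxOn_phi hX₁ hX₁max
    rw [← blockJ_mul_moorePenrose_mul_fromRows_zero hA₂ hcons K, Matrix.mul_assoc, colSpace,
      colSpace, mulVecLin_mul]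
    exact LinearMap.range_comp_le_range _ _
  · rw [e, fromCols_mul_fromBlocks_mul_fromRows, Matrix.one_mul, Matrix.mul_one]
    exact ⟨hRmem, hmax h⟩
  · rw [e, fromCols_mul_fromBlocks_mul_fromRows]
    refine ⟨⟨R, hRmem, rfl⟩, ?_⟩
    rintro _ ⟨X, hX, rfl⟩
    exact hmax h X hX
  · obtain ⟨K, rfl⟩ := hfactor h
    have hL : (fromRows (0 : Matrix (Fin m₂) (Fin m₁) ℂ) (K * B₂)ᴴ)ᴴ = fromCols 0 (K * B₂) := by
      rw [conjTranspose_fromRows_eq_fromCols_conjTranspose, conjTranspose_zero,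
        conjTranspose_conjTranspose]
    obtain ⟨hp, hn⟩ := inertia_fromBlocks_of_mul_eq hA₁ hJ (moorePenrose_isHermitian hJ)
      (blockJ_mul_moorePenrose_mul_fromRows_zero hA₂ hcons K)
    rw [hL] at hp hn
    rw [blockM, hp, hn]
    push_cast
    exact ⟨by ring, by ring⟩
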